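/- For integers $m,n$ let $BS(m,n)=\langle a,t \mid t a^m t^{-1}=a^n\rangle$ be the Baumslag--Solitar group. Call two groups (abstractly) commensurable if they have isomorphic subgroups of finite index. Let $k_1,n_1,k_2,n_2$ be integers, all greater than $1$. If $BS(k_1,k_1n_1)$ and $BS(k_2,k_2n_2)$ are commensurable, then $n_1=n_2$. -/

import Mathlib

/-- The defining relator of the Baumslag--Solitar group: `t a^m t⁻¹ (a^n)⁻¹`, in the free group on
two letters, where `a` is the letter `0` and `t` is the letter `1`. -/
def BSRelator (m n : ℤ) : FreeGroup (Fin 2) :=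
  FreeGroup.of 1 * FreeGroup.of 0 ^ m * (FreeGroup.of 1)⁻¹ * (FreeGroup.of 0 ^ n)⁻¹

/-- The Baumslag--Solitar group `BS(m, n) = ⟨a, t ∣ t a^m t⁻¹ = a^n⟩`. -/
abbrev BS (m n : ℤ) : Type :=
  PresentedGroup {BSRelator m n}

/-- Two groups are (abstractly) commensurable if they have isomorphic subgroups of finite index. -/
def AbstractlyCommensurable (G H : Type*) [Group G] [Group H] : Prop :=
  ∃ (G' : Subgroup G) (H' : Subgroup H),
    G'.FiniteIndex ∧ H'.FiniteIndex ∧ Nonempty (G' ≃* H')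

/-! `BS(k, kn)` is the HNN extension of `⟨a⟩` in which `t` conjugates `a ^ k` to `a ^ (k * n)`. The
invariant behind the proof is the set of subgroups cut out on `⟨a⟩` by centralizers: each is
trivial, all of `⟨a⟩`, or generated by some `a ^ (k * n ^ j)` (`forall_commute_or_exists_iff`), and
every `j ≥ 1` occurs. For `v = a ^ r` in a finite-index subgroup, `commSpectrum v` therefore
consists, up to the value `1` and the term `j = 0`, of the numbers `k * n ^ j / gcd(r, k * n ^ j)`.
This sequence is eventually geometric of ratio `n`, so the spectrum determines `n`.

An isomorphism of finite-index subgroups preserves the spectrum, but the image of `v` must again be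
conjugate to a power of `a`. This holds because two distinct positive powers of `v` are conjugate,
which the growth of word length forbids for elements not conjugate into the base
(`exists_conj_of_of_pow_conj`). -/

namespace HNNExtension

/-! ### Word length and cyclic reduction in HNN extensions -/

open NormalWord

variable {G : Type*} [Group G] {A B : Subgroup G} (φ : A ≃* B)

/-- The element of the HNN extension spelled by a list of syllables `t ^ u * g`. -/
def syllableProd (L : List (ℤˣ × G)) : HNNExtension G A B φ :=
  (L.map fun x => t ^ (x.1 : ℤ) * of x.2).prod

@[simp]
theorem syllableProd_nil : syllableProd φ [] = 1 := rfl

@[simp]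
theorem syllableProd_cons (x : ℤˣ × G) (L : List (ℤˣ × G)) :
    syllableProd φ (x :: L) = t ^ (x.1 : ℤ) * of x.2 * syllableProd φ L := by
  simp [syllableProd]

@[simp]
theorem syllableProd_append (L L' : List (ℤˣ × G)) :
    syllableProd φ (L ++ L') = syllableProd φ L * syllableProd φ L' := by
  simp [syllableProd]

theorem syllableProd_flatten_replicate (m : ℕ) (L : List (ℤˣ × G)) :
    syllableProd φ (List.replicate m L).flatten = syllableProd φ L ^ m := by
  induction m with
  | zero => simp
  | succ m ih => simp [List.replicate_succ, ih, pow_succ']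

theorem reducedWord_prod (w : ReducedWord G A B) :
    w.prod φ = of w.head * syllableProd φ w.toList := rfl

theorem zpow_units_mul_of (u : ℤˣ) (s : toSubgroup A B u) :
    (t ^ (u : ℤ) * of (s : G) : HNNExtension G A B φ) =
      of (toSubgroupEquiv φ u s : G) * t ^ (u : ℤ) := by
  rcases Int.units_eq_one_or u with rfl | rfl
  · rw [Units.val_one, zpow_one]
    exact t_mul_of (φ := φ) s
  · rw [Units.val_neg, Units.val_one, zpow_neg, zpow_one]
    exact inv_t_mul_of (φ := φ) s

variable (A B) in
/-- Two consecutive syllables of a word admit no cancellation. -/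
def NoCancel (x y : ℤˣ × G) : Prop :=
  x.2 ∈ toSubgroup A B x.1 → x.1 = y.1

theorem exists_isChain_mul_of {L : List (ℤˣ × G)} (hL : L.IsChain (NoCancel A B))
    (hne : L ≠ []) (y : G) :
    ∃ L' : List (ℤˣ × G), L'.IsChain (NoCancel A B) ∧ L'.map Prod.fst = L.map Prod.fst ∧
      syllableProd φ L' = syllableProd φ L * of y := by
  obtain ⟨K, ⟨u, b⟩, rfl⟩ := List.eq_nil_or_concat L |>.resolve_left hne
  rw [List.concat_eq_append] at hL
  refine ⟨K ++ [(u, b * y)], ?_, by simp, by simp [mul_assoc]⟩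
  rw [List.isChain_append] at hL ⊢
  refine ⟨hL.1, by simp, ?_⟩
  intro x hx z hz
  have := hL.2.2 x hx (u, b) (by simp)
  simp only [List.head?_cons, Option.mem_def, Option.some.injEq] at hz
  subst hz
  exact this

/-- Absorbing `y` into the last syllable makes both sides reduced words for one element; their heads
`x` and `1` then agree modulo the associated subgroup of the first stable letter. -/
theorem mem_toSubgroup_of_of_mul_syllableProd {u : ℤˣ} {g x y : G} {L : List (ℤˣ × G)}
    (hL : ((u, g) :: L).IsChain (NoCancel A B))
    (h : of x * syllableProd φ ((u, g) :: L) = syllableProd φ ((u, g) :: L) * of y) :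
    x ∈ toSubgroup A B (-u) := by
  obtain ⟨L', hL', hfst, hprod⟩ := exists_isChain_mul_of φ hL (by simp) y
  have := (ReducedWord.map_fst_eq_and_of_prod_eq φ
    (w₁ := ⟨x, _, hL⟩) (w₂ := ⟨1, L', hL'⟩) (by
      rw [reducedWord_prod, reducedWord_prod]
      simp only [hprod, h, map_one, one_mul])).2 u (by simp)
  simpa using this

/-- The number of occurrences of the stable letter in a reduced word. -/
noncomputable def tLength (g : HNNExtension G A B φ) : ℕ :=
  (g • (empty : NormalWord (Classical.choice (TransversalPair.nonempty G A B)))).toList.length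

/-- Normalizing a reduced word alters only its base-group letters, so the length does not depend on
the chosen transversal. -/
theorem tLength_prod (w : ReducedWord G A B) : tLength φ (w.prod φ) = w.toList.length := by
  obtain ⟨w', h1, h2, -⟩ := ReducedWord.exists_normalWord_prod_eq φ
    (Classical.choice (TransversalPair.nonempty G A B)) w
  rw [tLength, ← h1, prod_smul_empty]
  simpa using congrArg List.length h2

theorem tLength_syllableProd {L : List (ℤˣ × G)} (hL : L.IsChain (NoCancel A B)) :
    tLength φ (syllableProd φ L) = L.length := by
  simpa [reducedWord_prod] using tLength_prod φ ⟨1, L, hL⟩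

theorem exists_reducedWord_prod_eq (g : HNNExtension G A B φ) :
    ∃ w : ReducedWord G A B, w.prod φ = g :=
  ⟨(g • (empty : NormalWord (Classical.choice
    (TransversalPair.nonempty G A B)))).toReducedWord, by simp⟩

theorem length_unitsSMul_le {d : TransversalPair G A B} (u : ℤˣ) (w : NormalWord d) :
    (unitsSMul φ u w).toList.length ≤ w.toList.length + 1 := by
  rw [unitsSMul]
  split_ifs with h
  · cases w using consRecOn with
    | ofGroup => simp [Cancels] at h
    | cons g u' w h1 h2 =>
      simp only [unitsSMulWithCancel, consRecOn_cons, group_smul_toList, cons_toList,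
        List.length_cons]
      omega
  · simp

theorem length_syllableProd_smul_le {d : TransversalPair G A B} (L : List (ℤˣ × G))
    (w : NormalWord d) :
    (syllableProd φ L • w).toList.length ≤ L.length + w.toList.length := by
  induction L with
  | nil => simp
  | cons x L ih =>
    rw [syllableProd_cons, mul_smul, mul_smul, t_pow_smul_eq_unitsSMul, of_smul_eq_smul]
    have := length_unitsSMul_le φ x.1 (x.2 • (syllableProd φ L • w))
    rw [group_smul_toList] at this
    simp only [List.length_cons]
    omega

theorem tLength_mul_le (g h : HNNExtension G A B φ) :
    tLength φ (g * h) ≤ tLength φ g + tLength φ h := by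
  obtain ⟨w, rfl⟩ := exists_reducedWord_prod_eq φ g
  rw [tLength_prod, tLength, mul_smul, reducedWord_prod, mul_smul, of_smul_eq_smul,
    group_smul_toList]
  exact length_syllableProd_smul_le φ _ _

@[simp]
theorem tLength_of (g : G) : tLength φ (of g) = 0 := by
  simpa [ReducedWord.prod] using tLength_prod φ (⟨g, [], List.isChain_nil⟩ : ReducedWord G A B)

theorem tLength_syllableProd_le (L : List (ℤˣ × G)) :
    tLength φ (syllableProd φ L) ≤ L.length := by
  simpa [tLength] using length_syllableProd_smul_le φ L
    (empty : NormalWord (Classical.choice (TransversalPair.nonempty G A B)))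

theorem isChain_flatten_replicate {α : Type*} {R : α → α → Prop} {L : List α}
    (hL : (L ++ L).IsChain R) (m : ℕ) : (List.replicate m L).flatten.IsChain R := by
  rw [List.isChain_append] at hL
  induction m with
  | zero => simp
  | succ m ih =>
    rw [List.replicate_succ, List.flatten_cons, List.isChain_append]
    refine ⟨hL.1, ih, fun x hx y hy => hL.2.2 x hx y ?_⟩
    cases m with
    | zero => simp at hy
    | succ m =>
      cases L with
      | nil => simp at hx
      | cons a L => simpa [List.replicate_succ] using hy

theorem tLength_syllableProd_pow {L : List (ℤˣ × G)} (hL : (L ++ L).IsChain (NoCancel A B))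
    (m : ℕ) : tLength φ (syllableProd φ L ^ m) = m * L.length := by
  rw [← syllableProd_flatten_replicate,
    tLength_syllableProd φ (isChain_flatten_replicate hL m)]
  simp

/-- Every element of an HNN extension is conjugate to an element of the base group or to a
cyclically reduced word. -/
theorem exists_conj_cyclicallyReduced (g : HNNExtension G A B φ) :
    (∃ x b, g = x * of b * x⁻¹) ∨
      ∃ x L, L ≠ [] ∧ (L ++ L).IsChain (NoCancel A B) ∧ g = x * syllableProd φ L * x⁻¹ := by
  induction hn : tLength φ g using Nat.strong_induction_on generalizing g with
  | _ n ih =>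
  obtain ⟨⟨g₀, L₀, hL₀⟩, rfl⟩ := exists_reducedWord_prod_eq φ g
  rw [tLength_prod] at hn
  simp only at hn
  rw [reducedWord_prod]
  simp only
  by_cases hne : L₀ = []
  · subst hne
    exact Or.inl ⟨1, g₀, by simp⟩
  obtain ⟨L, hL, hfst, hprod⟩ := exists_isChain_mul_of φ hL₀ hne g₀
  have hlen : L.length = n := by rw [← hn]; simpa using congrArg List.length hfst
  have hg : of g₀ * syllableProd φ L₀ = of g₀ * syllableProd φ L * (of g₀)⁻¹ := by
    rw [hprod]; group
  have hLne : L ≠ [] := by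
    rintro rfl
    exact hne (by simpa using hfst.symm)
  by_cases hc : (L ++ L).IsChain (NoCancel A B)
  · exact Or.inr ⟨of g₀, L, hLne, hc, hg⟩
  obtain ⟨K, ⟨u, b⟩, rfl⟩ := List.eq_nil_or_concat L |>.resolve_left hLne
  rw [List.concat_eq_append] at hL hlen hg hc
  replace hc := mt (fun h => List.isChain_append.2 ⟨hL, hL, h⟩) hc
  simp only [List.getLast?_append, List.getLast?_singleton, Option.some_or,
    Option.mem_def, Option.some.injEq, forall_eq', not_forall, NoCancel] at hc
  obtain ⟨y, hy, hb, huy⟩ := hc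
  cases K with
  | nil =>
    simp only [List.nil_append, List.head?_cons, Option.some.injEq] at hy
    exact absurd (by rw [← hy]) huy
  | cons z K =>
    simp only [List.cons_append, List.head?_cons, Option.some.injEq] at hy
    subst hy
    have hu : z.1 = -u := by rwa [← Int.units_ne_iff_eq_neg, ne_comm]
    -- The last stable letter cancels cyclically against the first; conjugating by `t ^ u` removes
    -- both.
    have hconj : syllableProd φ (z :: K ++ [(u, b)]) = (t ^ (u : ℤ))⁻¹ *
        (of z.2 * syllableProd φ K * of (toSubgroupEquiv φ u ⟨b, hb⟩ : G)) * t ^ (u : ℤ) := by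
      have := zpow_units_mul_of φ u ⟨b, hb⟩
      simp only at this
      simp [hu, this, mul_assoc]
    set c : HNNExtension G A B φ :=
      of z.2 * syllableProd φ K * of (toSubgroupEquiv φ u ⟨b, hb⟩ : G) with hcdef
    have hclen : tLength φ c < n := by
      have h1 := tLength_mul_le φ (of z.2 * syllableProd φ K)
        (of (toSubgroupEquiv φ u ⟨b, hb⟩ : G))
      have h2 := tLength_mul_le φ (of z.2) (syllableProd φ K)
      have h3 := tLength_syllableProd_le φ K
      rw [tLength_of] at h1 h2
      simp at hlen
      rw [hcdef]
      omega
    have hgc : of g₀ * syllableProd φ L₀ =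
        (of g₀ * (t ^ (u : ℤ))⁻¹) * c * (of g₀ * (t ^ (u : ℤ))⁻¹)⁻¹ := by
      rw [hg, hconj]; group
    rcases ih _ hclen c rfl with ⟨x, b', h⟩ | ⟨x, L, h1, h2, h⟩
    · exact Or.inl ⟨of g₀ * (t ^ (u : ℤ))⁻¹ * x, b', by rw [hgc, h]; group⟩
    · exact Or.inr ⟨of g₀ * (t ^ (u : ℤ))⁻¹ * x, L, h1, h2, by rw [hgc, h]; group⟩

/-- An element two distinct powers of which are conjugate is conjugate into the base group. -/
theorem exists_conj_of_of_pow_conj {g h : HNNExtension G A B φ} {p q : ℕ} (hpq : p < q)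
    (hconj : h * g ^ p * h⁻¹ = g ^ q) : ∃ x b, g = x * of b * x⁻¹ := by
  refine (exists_conj_cyclicallyReduced φ g).resolve_right ?_
  rintro ⟨x, L, hne, hL, rfl⟩
  have hlen : 0 < L.length := List.length_pos_iff.2 hne
  set c := syllableProd φ L with hc
  set y := x⁻¹ * h * x with hy
  have hyc : y * c ^ p * y⁻¹ = c ^ q := by
    rw [conj_pow, conj_pow] at hconj
    have : c ^ q = x⁻¹ * (x * c ^ q * x⁻¹) * x := by group
    rw [this, ← hconj, hy]; group
  -- Conjugation by `y` adds less than `m` to the length, while the lengths of `c ^ (p * m)` and `c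
  -- ^ (q * m)` differ by at least `m`.
  set m := tLength φ y + tLength φ y⁻¹ + 1 with hm
  have h1 : tLength φ (y * (c ^ (p * m)) * y⁻¹) = q * m * L.length := by
    rw [pow_mul, ← conj_pow, hyc, ← pow_mul, tLength_syllableProd_pow φ hL]
  have h2 := tLength_mul_le φ (y * (c ^ (p * m))) y⁻¹
  have h3 := tLength_mul_le φ y (c ^ (p * m))
  rw [tLength_syllableProd_pow φ hL] at h3
  have h4 : (p * m + m) * L.length ≤ q * m * L.length :=
    Nat.mul_le_mul_right _ (by nlinarith)
  have h5 : m ≤ m * L.length := Nat.le_mul_of_pos_right _ hlen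
  rw [add_mul] at h4
  omega

end HNNExtension

/-! ### Powers of `a` commuting with a given element of `BS(k, kn)` -/

namespace BaumslagSolitar

open HNNExtension HNNExtension.NormalWord Multiplicative

/-- The subgroup `kℤ` of `ℤ`, written multiplicatively. -/
def lowerSubgroup (k : ℕ) : Subgroup (Multiplicative ℤ) :=
  Subgroup.zpowers (ofAdd (k : ℤ))

/-- The subgroup `knℤ` of `ℤ`, written multiplicatively. -/
def upperSubgroup (k n : ℕ) : Subgroup (Multiplicative ℤ) :=
  (lowerSubgroup k).map (powMonoidHom n)

theorem ofAdd_mem_lowerSubgroup {k : ℕ} {N : ℤ} :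
    ofAdd N ∈ lowerSubgroup k ↔ (k : ℤ) ∣ N := by
  rw [lowerSubgroup, Subgroup.mem_zpowers_iff]
  constructor
  · rintro ⟨z, hz⟩
    exact ⟨z, by rw [← ofAdd_zsmul] at hz; rw [← ofAdd.injective hz]; simp [mul_comm]⟩
  · rintro ⟨z, rfl⟩
    exact ⟨z, by rw [← ofAdd_zsmul]; simp [mul_comm]⟩

theorem ofAdd_mem_upperSubgroup {k n : ℕ} {N : ℤ} :
    ofAdd N ∈ upperSubgroup k n ↔ (k * n : ℤ) ∣ N := by
  rw [upperSubgroup, Subgroup.mem_map]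
  constructor
  · rintro ⟨x, hx, h⟩
    obtain ⟨z, rfl⟩ := ofAdd.surjective x
    obtain ⟨q, rfl⟩ := ofAdd_mem_lowerSubgroup.1 hx
    rw [powMonoidHom_apply, ← ofAdd_nsmul] at h
    exact ⟨q, by rw [← ofAdd.injective h]; simp; ring⟩
  · rintro ⟨q, rfl⟩
    exact ⟨ofAdd (k * q), ofAdd_mem_lowerSubgroup.2 ⟨q, rfl⟩, by
      rw [powMonoidHom_apply, ← ofAdd_nsmul]; congr 1; simp; ring⟩

variable {k n : ℕ}

/-- The syllables of `t ^ (±(i + 1)) * a`. -/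
def ramp (u : ℤˣ) (i : ℕ) : List (ℤˣ × Multiplicative ℤ) :=
  List.replicate i (u, 1) ++ [(u, ofAdd 1)]

theorem isChain_ramp (u : ℤˣ) (i : ℕ) :
    (ramp u i).IsChain (NoCancel (lowerSubgroup k) (upperSubgroup k n)) := by
  refine (List.pairwise_of_forall_mem_list fun x hx y hy _ => ?_).isChain
  have h : ∀ z ∈ ramp u i, z.1 = u := by
    intro z hz
    simp only [ramp, List.mem_append, List.mem_replicate, List.mem_singleton] at hz
    rcases hz with ⟨-, rfl⟩ | rfl <;> rfl
  rw [h x hx, h y hy]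

theorem ofAdd_one_notMem_toSubgroup (hk : 1 < k) (u : ℤˣ) :
    ofAdd (1 : ℤ) ∉ toSubgroup (lowerSubgroup k) (upperSubgroup k n) u := by
  have hk' : ¬ (k : ℤ) ∣ 1 := by
    intro h
    have : k ∣ 1 := by exact_mod_cast h
    exact hk.ne' (Nat.dvd_one.1 this)
  rcases Int.units_eq_one_or u with rfl | rfl
  · exact fun h => hk' (ofAdd_mem_lowerSubgroup.1 h)
  · exact fun h => hk' ((Dvd.intro _ rfl).trans (ofAdd_mem_upperSubgroup.1 h))

/-- A ramp ends in `a`, which lies in neither associated subgroup because `k > 1`, so nothing that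
follows can cancel. -/
theorem isChain_ramp_append (hk : 1 < k) (u : ℤˣ) (i : ℕ) {L : List (ℤˣ × Multiplicative ℤ)}
    (hL : L.IsChain (NoCancel (lowerSubgroup k) (upperSubgroup k n))) :
    (ramp u i ++ L).IsChain (NoCancel (lowerSubgroup k) (upperSubgroup k n)) := by
  rw [List.isChain_append]
  refine ⟨isChain_ramp u i, hL, fun x hx y _ hxm => ?_⟩
  simp only [ramp, List.getLast?_append, List.getLast?_singleton, Option.some_or, Option.mem_def,
    Option.some.injEq] at hx
  subst hx
  exact absurd hxm (ofAdd_one_notMem_toSubgroup hk u)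

/-- Multiplication by `n` as an isomorphism from `kℤ` to `knℤ`. -/
noncomputable def scaleEquiv (k n : ℕ) [NeZero n] : lowerSubgroup k ≃* upperSubgroup k n :=
  (lowerSubgroup k).equivMapOfInjective (powMonoidHom n)
    (pow_left_injective (NeZero.ne n))

/-- `BS(k, kn)` as an HNN extension of the infinite cyclic group. -/
abbrev Ext (k n : ℕ) [NeZero n] : Type :=
  HNNExtension (Multiplicative ℤ) (lowerSubgroup k) (upperSubgroup k n) (scaleEquiv k n)

variable [NeZero n]

variable (k n) in
/-- The power `a ^ N` of the generator of the base group. -/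
noncomputable def aPow (N : ℤ) : Ext k n := of (ofAdd N)

theorem aPow_injective : Function.Injective (aPow k n) :=
  (of_injective _).comp ofAdd.injective

@[simp]
theorem aPow_zero : aPow k n 0 = 1 := map_one _

theorem aPow_pow (N : ℤ) (m : ℕ) : aPow k n N ^ m = aPow k n (N * m) := by
  rw [aPow, aPow, ← map_pow, ← ofAdd_nsmul]; simp [mul_comm]

theorem commute_aPow_of (N : ℤ) (g : Multiplicative ℤ) : Commute (aPow k n N) (of g) := by
  rw [Commute, SemiconjBy, aPow, ← map_mul, ← map_mul, mul_comm]

theorem t_mul_aPow (q : ℤ) : t * aPow k n (k * q) = aPow k n (k * n * q) * t := by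
  rw [aPow, aPow]
  have := t_mul_of (φ := scaleEquiv k n) ⟨ofAdd (k * q), ofAdd_mem_lowerSubgroup.2 ⟨q, rfl⟩⟩
  simp only at this
  rw [this]
  congr 2
  change (ofAdd (k * q : ℤ)) ^ n = _
  rw [← ofAdd_nsmul]; congr 1; simp; ring

/-- Effect of a letter `t ^ u` read from right to left on the depth of a word. -/
def depthStep (x : ℤˣ × Multiplicative ℤ) (d : ℕ) : ℕ :=
  if x.1 = 1 then d + 1 else d - 1

/-- The exponent `d` such that the powers of `a` that a reduced word conjugates into the base group
are the powers of `a ^ (k * n ^ d)`. -/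
def depth (L : List (ℤˣ × Multiplicative ℤ)) : ℕ := L.foldr depthStep 0

/-- The number of syllables with a given exponent of the stable letter. -/
def expCount (u : ℤˣ) (L : List (ℤˣ × Multiplicative ℤ)) : ℕ := (L.map Prod.fst).count u

theorem aPow_mul_syllable_one (q : ℤ) (g : Multiplicative ℤ) (x : Ext k n) :
    aPow k n (k * n * q) * (t ^ ((1 : ℤˣ) : ℤ) * of g * x) =
      t ^ ((1 : ℤˣ) : ℤ) * of g * (aPow k n (k * q) * x) := by
  have h := t_mul_aPow (k := k) (n := n) q
  have h' := (commute_aPow_of (k := k) (n := n) (k * q) g).eq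
  rw [Units.val_one, zpow_one]
  simp only [← mul_assoc]
  rw [← h, mul_assoc t, h', ← mul_assoc]

theorem aPow_mul_syllable_neg_one (q : ℤ) (g : Multiplicative ℤ) (x : Ext k n) :
    aPow k n (k * q) * (t ^ ((-1 : ℤˣ) : ℤ) * of g * x) =
      t ^ ((-1 : ℤˣ) : ℤ) * of g * (aPow k n (k * n * q) * x) := by
  have h : aPow k n (k * q) * t⁻¹ = t⁻¹ * aPow k n (k * n * q) := by
    rw [mul_inv_eq_iff_eq_mul, mul_assoc, ← t_mul_aPow, inv_mul_cancel_left]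
  have h' := (commute_aPow_of (k := k) (n := n) (k * n * q) g).eq
  rw [Units.val_neg, Units.val_one, zpow_neg, zpow_one]
  simp only [← mul_assoc]
  rw [h, mul_assoc t⁻¹, h', ← mul_assoc]

/-- The power of `a` is pushed through the word: passing `t` requires an exponent divisible by `k *
n` and divides it by `n`; passing `t⁻¹` requires divisibility by `k` and multiplies it by `n`.
Divisibility by `k` is needed even when the remaining word has depth `0`, whence the truncated
subtraction in `depthStep`. -/
theorem dvd_and_eq_of_aPow_mul_syllableProd {L : List (ℤˣ × Multiplicative ℤ)}
    (hL : L.IsChain (NoCancel (lowerSubgroup k) (upperSubgroup k n))) {N N' : ℤ}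
    (h : aPow k n N * syllableProd _ L = syllableProd _ L * aPow k n N') :
    (L ≠ [] → (k * n ^ depth L : ℤ) ∣ N) ∧
      N * (n : ℤ) ^ expCount (-1) L = N' * (n : ℤ) ^ expCount 1 L := by
  have hn : (n : ℤ) ≠ 0 := by exact_mod_cast NeZero.ne n
  induction L generalizing N with
  | nil =>
    rw [syllableProd_nil, mul_one, one_mul] at h
    simp [aPow_injective h, expCount]
  | cons x L ih =>
    obtain ⟨u, g⟩ := x
    have hmem := mem_toSubgroup_of_of_mul_syllableProd _ hL h
    have hL' := (List.isChain_cons.1 hL).2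
    rcases Int.units_eq_one_or u with rfl | rfl
    · obtain ⟨q, rfl⟩ := ofAdd_mem_upperSubgroup.1 hmem
      rw [syllableProd_cons, aPow_mul_syllable_one, mul_assoc _ (syllableProd _ L),
        mul_right_inj] at h
      obtain ⟨h1, h2⟩ := ih hL' h
      refine ⟨fun _ => ?_, ?_⟩
      · by_cases hne : L = []
        · subst hne
          exact ⟨q, by simp [depth, depthStep]⟩
        · obtain ⟨z, hz⟩ := h1 hne
          refine ⟨z, ?_⟩
          simp only [depth, List.foldr_cons, depthStep, if_true] at hz ⊢
          linear_combination (n : ℤ) * hz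
      · simp only [expCount, List.map_cons, List.count_cons_self] at h2 ⊢
        rw [List.count_cons_of_ne (by decide)]
        linear_combination (n : ℤ) * h2
    · rw [neg_neg] at hmem
      obtain ⟨q, rfl⟩ := ofAdd_mem_lowerSubgroup.1 hmem
      rw [syllableProd_cons, aPow_mul_syllable_neg_one, mul_assoc _ (syllableProd _ L),
        mul_right_inj] at h
      obtain ⟨h1, h2⟩ := ih hL' h
      refine ⟨fun _ => ?_, ?_⟩
      · have hstep : depth ((-1, g) :: L) = depth L - 1 := by simp [depth, depthStep]
        rw [hstep]
        rcases hd : depth L with _ | d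
        · exact ⟨q, by simp⟩
        · have hne : L ≠ [] := by rintro rfl; simp [depth] at hd
          obtain ⟨z, hz⟩ := h1 hne
          rw [hd] at hz
          exact ⟨z, mul_left_cancel₀ hn (by
            simp only [Nat.add_sub_cancel]; linear_combination hz)⟩
      · simp only [expCount, List.map_cons, List.count_cons_self] at h2 ⊢
        rw [List.count_cons_of_ne (by decide)]
        linear_combination h2

theorem exists_aPow_mul_syllableProd (L : List (ℤˣ × Multiplicative ℤ)) {N : ℤ}
    (h : (k * n ^ depth L : ℤ) ∣ N) :
    ∃ N', aPow k n N * syllableProd _ L = syllableProd _ L * aPow k n N' := by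
  induction L generalizing N with
  | nil => exact ⟨N, by simp⟩
  | cons x L ih =>
    obtain ⟨u, g⟩ := x
    obtain ⟨z, rfl⟩ := h
    rcases Int.units_eq_one_or u with rfl | rfl
    · have hN : (k * n ^ depth ((1, g) :: L) * z : ℤ) = k * n * (n ^ depth L * z) := by
        simp only [depth, List.foldr_cons, depthStep, if_true]; ring
      obtain ⟨N', h⟩ := ih (N := k * (n ^ depth L * z)) ⟨z, by ring⟩
      exact ⟨N', by rw [hN, syllableProd_cons, aPow_mul_syllable_one, h, ← mul_assoc]⟩
    · have hN : (k * n ^ depth ((-1, g) :: L) * z : ℤ) = k * (n ^ (depth L - 1) * z) := by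
        simp [depth, depthStep]; ring
      obtain ⟨N', h⟩ := ih (N := k * n * (n ^ (depth L - 1) * z)) (by
        rcases depth L with _ | d
        · exact ⟨n * z, by ring⟩
        · exact ⟨z, by simp only [Nat.add_sub_cancel]; ring⟩)
      exact ⟨N', by rw [hN, syllableProd_cons, aPow_mul_syllable_neg_one, h, ← mul_assoc]⟩

theorem expCount_eq_of_commute (hn : 1 < n) {L : List (ℤˣ × Multiplicative ℤ)}
    (hL : L.IsChain (NoCancel (lowerSubgroup k) (upperSubgroup k n))) {N : ℤ} (hN : N ≠ 0)
    (h : Commute (aPow k n N) (syllableProd _ L)) : expCount (-1) L = expCount 1 L := by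
  have := mul_left_cancel₀ hN (dvd_and_eq_of_aPow_mul_syllableProd hL h.eq).2
  exact Nat.pow_right_injective hn (by exact_mod_cast this)

theorem commute_aPow_syllableProd_iff {L : List (ℤˣ × Multiplicative ℤ)}
    (hL : L.IsChain (NoCancel (lowerSubgroup k) (upperSubgroup k n))) (hne : L ≠ [])
    (hcount : expCount (-1) L = expCount 1 L) {N : ℤ} :
    Commute (aPow k n N) (syllableProd _ L) ↔ (k * n ^ depth L : ℤ) ∣ N := by
  refine ⟨fun h => (dvd_and_eq_of_aPow_mul_syllableProd hL h.eq).1 hne, fun h => ?_⟩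
  obtain ⟨N', hN'⟩ := exists_aPow_mul_syllableProd L h
  have h2 := (dvd_and_eq_of_aPow_mul_syllableProd hL hN').2
  rw [hcount] at h2
  have hn : (n : ℤ) ≠ 0 := by exact_mod_cast NeZero.ne n
  obtain rfl := mul_right_cancel₀ (pow_ne_zero _ hn) h2
  exact hN'

/-- The head of a reduced word commutes with `a` and can be dropped. The nonzero `N₀` rules out a
trivial intersection: it forces equally many letters `t` and `t⁻¹`, so any power of `a` that passes
through the word emerges unchanged. -/
theorem forall_commute_or_exists_iff (hn : 1 < n) (g : Ext k n) {N₀ : ℤ} (hN₀ : N₀ ≠ 0)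
    (hg : Commute (aPow k n N₀) g) :
    (∀ N, Commute (aPow k n N) g) ∨
      ∃ j : ℕ, ∀ N, Commute (aPow k n N) g ↔ (k * n ^ j : ℤ) ∣ N := by
  obtain ⟨⟨x, L, hL⟩, rfl⟩ := exists_reducedWord_prod_eq _ g
  have key : ∀ N, Commute (aPow k n N) (ReducedWord.prod (scaleEquiv k n) ⟨x, L, hL⟩) ↔
      Commute (aPow k n N) (syllableProd (scaleEquiv k n) L) := fun N => by
    rw [reducedWord_prod]
    refine ⟨fun h => ?_, fun h => (commute_aPow_of N x).mul_right h⟩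
    simpa using (commute_aPow_of N x).inv_right.mul_right h
  simp only [key] at hg ⊢
  by_cases hne : L = []
  · subst hne
    exact Or.inl fun N => by simp
  · exact Or.inr ⟨depth L, fun N =>
      commute_aPow_syllableProd_iff hL hne (expCount_eq_of_commute hn hL hN₀ hg)⟩

/-- The syllables of `t ^ (i + 1) * a * t ^ (-(i + 1)) * a`. -/
def hill (i : ℕ) : List (ℤˣ × Multiplicative ℤ) := ramp 1 i ++ ramp (-1) i

theorem foldr_depthStep_ramp_one (i d : ℕ) :
    (ramp 1 i).foldr depthStep d = d + (i + 1) := by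
  simp only [ramp, List.foldr_append, List.foldr_cons, List.foldr_nil]
  induction i with
  | zero => simp [depthStep]
  | succ i ih => rw [List.replicate_succ, List.foldr_cons, ih]; simp [depthStep]; ring

theorem foldr_depthStep_ramp_neg_one (i d : ℕ) :
    (ramp (-1) i).foldr depthStep d = d - (i + 1) := by
  simp only [ramp, List.foldr_append, List.foldr_cons, List.foldr_nil]
  induction i with
  | zero => simp [depthStep]
  | succ i ih => rw [List.replicate_succ, List.foldr_cons, ih]; simp [depthStep]; omega

theorem depth_flatten_replicate_hill (i m : ℕ) :
    depth (List.replicate (m + 1) (hill i)).flatten = i + 1 := by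
  induction m with
  | zero =>
    simp [depth, hill, List.foldr_append, foldr_depthStep_ramp_one, foldr_depthStep_ramp_neg_one]
  | succ m ih =>
    rw [List.replicate_succ, List.flatten_cons, depth, List.foldr_append, ← depth, ih, hill,
      List.foldr_append, foldr_depthStep_ramp_one, foldr_depthStep_ramp_neg_one]
    omega

theorem expCount_append (u : ℤˣ) (L L' : List (ℤˣ × Multiplicative ℤ)) :
    expCount u (L ++ L') = expCount u L + expCount u L' := by
  simp [expCount]

theorem expCount_hill (i : ℕ) : expCount (-1) (hill i) = expCount 1 (hill i) := by
  simp [expCount, hill, ramp, List.count_replicate]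

theorem expCount_flatten_replicate_hill (i m : ℕ) :
    expCount (-1) (List.replicate m (hill i)).flatten =
      expCount 1 (List.replicate m (hill i)).flatten := by
  induction m with
  | zero => rfl
  | succ m ih =>
    rw [List.replicate_succ, List.flatten_cons, expCount_append, expCount_append, ih,
      expCount_hill]

/-- Read from the right, each hill brings the depth back to `0` and then up to `i + 1`, so all
positive powers have the same depth. Some such power lies in any given finite-index subgroup. -/
theorem commute_aPow_hill_pow_iff (hk : 1 < k) (i : ℕ) {m : ℕ} (hm : 0 < m) (N : ℤ) :
    Commute (aPow k n N) (syllableProd _ (hill i) ^ m) ↔ (k * n ^ (i + 1) : ℤ) ∣ N := by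
  obtain ⟨m, rfl⟩ := Nat.exists_eq_succ_of_ne_zero hm.ne'
  rw [← syllableProd_flatten_replicate, commute_aPow_syllableProd_iff, Nat.succ_eq_add_one,
    depth_flatten_replicate_hill]
  · refine isChain_flatten_replicate ?_ _
    simp only [hill, List.append_assoc]
    exact isChain_ramp_append hk _ _ (isChain_ramp_append hk _ _
      (isChain_ramp_append hk _ _ (isChain_ramp _ _)))
  · simp [List.replicate_succ, hill, ramp]
  · exact expCount_flatten_replicate_hill i _

theorem t_pow_mul_aPow (s : ℕ) (q : ℤ) :
    t ^ s * aPow k n (k * q) * (t ^ s)⁻¹ = aPow k n (k * n ^ s * q) := by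
  rw [mul_inv_eq_iff_eq_mul]
  induction s generalizing q with
  | zero => simp
  | succ s ih =>
    rw [pow_succ, mul_assoc, t_mul_aPow, mul_assoc (k : ℤ), ← mul_assoc, ih, mul_assoc]
    congr 2
    ring

end BaumslagSolitar

/-! ### The commutation spectrum and eventually geometric sequences -/

/-- The positive integers `N` such that, for some `h`, the powers of `v` commuting with `h` are
exactly the powers of `v ^ N`. -/
def commSpectrum {G : Type*} [Group G] (v : G) : Set ℕ :=
  {N | 0 < N ∧ ∃ h : G, ∀ m : ℕ, Commute (v ^ m) h ↔ N ∣ m}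

theorem commSpectrum_subset_map {G H : Type*} [Group G] [Group H] (e : G ≃* H) (v : G) :
    commSpectrum v ⊆ commSpectrum (e v) := by
  rintro N ⟨hN, h, hh⟩
  refine ⟨hN, e h, fun m => ?_⟩
  rw [← hh, ← map_pow]
  simp only [Commute, SemiconjBy, ← map_mul, e.injective.eq_iff]

theorem commSpectrum_map {G H : Type*} [Group G] [Group H] (e : G ≃* H) (v : G) :
    commSpectrum (e v) = commSpectrum v :=
  ((commSpectrum_subset_map e.symm (e v)).trans_eq (by simp)).antisymm
    (commSpectrum_subset_map e v)

/-- A monotone sequence of naturals that is eventually geometric with ratio `n`. -/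
def EventuallyGeometric (f : ℕ → ℕ) (n : ℕ) : Prop :=
  Monotone f ∧ ∃ J, 0 < f J ∧ ∀ j, J ≤ j → f (j + 1) = n * f j

theorem EventuallyGeometric.exists_lt {f : ℕ → ℕ} {n : ℕ} (hf : EventuallyGeometric f n)
    (hn : 1 < n) (X : ℕ) : ∃ j, X < f j := by
  obtain ⟨-, J, hJ, h⟩ := hf
  have : ∀ i, i < f (J + i) := by
    intro i
    induction i with
    | zero => simpa using hJ
    | succ i ih =>
      rw [← add_assoc, h _ (Nat.le_add_right _ _)]
      nlinarith
  exact ⟨J + X, this X⟩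

/-- Far out, `f j < n * f j` are both values of `g`, and the value of `g` following `f j` is `m * f
j`, which cannot exceed `n * f j`. -/
theorem EventuallyGeometric.ratio_le {f g : ℕ → ℕ} {n m : ℕ} (hf : EventuallyGeometric f n)
    (hg : EventuallyGeometric g m) (hn : 1 < n)
    (hfg : ∀ j, 1 ≤ j → f j = 1 ∨ ∃ i, f j = g i) : m ≤ n := by
  obtain ⟨j₀, hj₀⟩ := hf.exists_lt hn 1
  obtain ⟨-, I, -, hI⟩ := id hg
  obtain ⟨j₁, hj₁⟩ := hf.exists_lt hn (g I)
  obtain ⟨-, J, -, hJ⟩ := id hf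
  -- Large enough that `f j` exceeds both `1` and `g I` and lies in the geometric range of `f`; the
  -- final `1` gives `1 ≤ j`.
  set j := j₀ + j₁ + J + 1 with hj
  have h1 : 1 < f j := hj₀.trans_le (hf.1 (by omega))
  have hgI : g I < f j := hj₁.trans_le (hf.1 (by omega))
  have hstep : f (j + 1) = n * f j := hJ j (by omega)
  obtain ⟨a, ha⟩ := (hfg j (by omega)).resolve_left h1.ne'
  obtain ⟨b, hb⟩ := (hfg (j + 1) (by omega)).resolve_left (by rw [hstep]; nlinarith)
  have hIa : I < a := hg.1.reflect_lt (by rwa [← ha])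
  have hab : a < b := hg.1.reflect_lt (by rw [← ha, ← hb, hstep]; nlinarith)
  have := hg.1 (Nat.succ_le_of_lt hab)
  rw [Nat.succ_eq_add_one, hI a hIa.le, ← hb, ← ha, hstep] at this
  exact Nat.le_of_mul_le_mul_right this (by omega)

theorem EventuallyGeometric.ratio_eq {f g : ℕ → ℕ} {n m : ℕ} {S : Set ℕ}
    (hf : EventuallyGeometric f n) (hg : EventuallyGeometric g m) (hn : 1 < n) (hm : 1 < m)
    (hfS : ∀ j, 1 ≤ j → f j ∈ S) (hgS : ∀ j, 1 ≤ j → g j ∈ S)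
    (hSf : ∀ N ∈ S, N = 1 ∨ ∃ j, N = f j) (hSg : ∀ N ∈ S, N = 1 ∨ ∃ j, N = g j) : n = m :=
  (hg.ratio_le hf hm fun j hj => hSf _ (hgS j hj)).antisymm
    (hf.ratio_le hg hn fun j hj => hSg _ (hfS j hj))

theorem Nat.dvd_mul_iff_div_gcd_dvd {a r m : ℕ} (hr : 0 < r) :
    a ∣ r * m ↔ a / Nat.gcd r a ∣ m := by
  have hg := Nat.gcd_pos_of_pos_left a hr
  constructor
  · intro h
    refine (Nat.coprime_div_gcd_div_gcd hg).symm.dvd_of_dvd_mul_left ?_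
    rw [Nat.div_mul_right_comm (Nat.gcd_dvd_left r a)]
    exact Nat.div_dvd_div (Nat.gcd_dvd_right r a) h
  · intro h
    have := Nat.mul_dvd_mul (Nat.gcd_dvd_left r a) h
    rwa [Nat.mul_div_cancel' (Nat.gcd_dvd_right r a)] at this

theorem dvd_mul_natCast_iff {k n : ℕ} {r : ℤ} (hr : r ≠ 0) (j m : ℕ) :
    (k * n ^ j : ℤ) ∣ r * m ↔ k * n ^ j / Nat.gcd r.natAbs (k * n ^ j) ∣ m := by
  rw [← Nat.dvd_mul_iff_div_gcd_dvd (Int.natAbs_pos.2 hr), ← Int.natCast_dvd_natCast,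
    ← Int.dvd_natAbs (b := r * m), Int.natAbs_mul, Int.natAbs_natCast]
  push_cast
  rfl

theorem eventuallyGeometric_div_gcd {k n r : ℕ} (hk : 0 < k) (hn : 0 < n) (hr : 0 < r) :
    EventuallyGeometric (fun j => k * n ^ j / Nat.gcd r (k * n ^ j)) n := by
  have hpos : ∀ j, 0 < k * n ^ j := fun j => by positivity
  have hdvd : ∀ i j, i ≤ j → k * n ^ i ∣ k * n ^ j := fun i j hij =>
    Nat.mul_dvd_mul_left k (pow_dvd_pow n hij)
  have hgpos : ∀ j, 0 < Nat.gcd r (k * n ^ j) := fun j => Nat.gcd_pos_of_pos_left _ hr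
  have hqpos : ∀ j, 0 < k * n ^ j / Nat.gcd r (k * n ^ j) := fun j =>
    Nat.div_pos (Nat.le_of_dvd (hpos j) (Nat.gcd_dvd_right _ _)) (hgpos j)
  refine ⟨fun i j hij => Nat.le_of_dvd (hqpos j) ?_, ?_⟩
  · rw [← Nat.dvd_mul_iff_div_gcd_dvd hr]
    exact (hdvd i j hij).trans ((Nat.dvd_mul_iff_div_gcd_dvd hr).2 dvd_rfl)
  -- The gcds form a divisibility chain bounded by `r`; `J` is an index where the gcd is largest, so
  -- it is constant from there on.
  · set J := Function.argmin (fun j => r - Nat.gcd r (k * n ^ j)) with hJ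
    have hconst : ∀ j, J ≤ j → Nat.gcd r (k * n ^ j) = Nat.gcd r (k * n ^ J) := by
      intro j hj
      have h1 := Function.argmin_le (fun j => r - Nat.gcd r (k * n ^ j)) j
      have h2 := Nat.le_of_dvd (hgpos j) (Nat.gcd_dvd_gcd_of_dvd_right r (hdvd J j hj))
      have h3 := Nat.le_of_dvd hr (Nat.gcd_dvd_left r (k * n ^ j))
      simp only [← hJ] at h1
      omega
    refine ⟨J, hqpos J, fun j hj => ?_⟩
    have h := hconst (j + 1) (by omega)
    rw [← hconst j hj] at h
    simp only [h]
    rw [← Nat.mul_div_assoc _ (Nat.gcd_dvd_right _ _)]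
    congr 1
    ring

/-! ### Spectra in finite-index subgroups and the comparison of ratios -/

namespace BaumslagSolitar

open HNNExtension HNNExtension.NormalWord Multiplicative

variable {k n : ℕ} [NeZero n]

theorem commute_coe_pow_iff {H : Subgroup (Ext k n)} {v : H} {g : Ext k n} {r : ℤ}
    (hv : (v : Ext k n) = g * aPow k n r * g⁻¹) (h : H) (m : ℕ) :
    Commute (v ^ m) h ↔ Commute (aPow k n (r * m)) (g⁻¹ * h * g) := by
  have hh : (h : Ext k n) = g * (g⁻¹ * h * g) * g⁻¹ := by group
  set y := g⁻¹ * (h : Ext k n) * g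
  rw [← aPow_pow, Commute, SemiconjBy, ← H.subtype_injective.eq_iff]
  simp only [map_mul, map_pow, Subgroup.subtype_apply]
  rw [hv, hh, conj_pow, conj_mul, conj_mul, mul_left_inj, mul_right_inj]
  rfl

theorem eq_one_or_exists_of_mem_commSpectrum (hn : 1 < n) {H : Subgroup (Ext k n)} {v : H}
    {g : Ext k n} {r : ℤ} (hr : r ≠ 0) (hv : (v : Ext k n) = g * aPow k n r * g⁻¹) {N : ℕ}
    (hN : N ∈ commSpectrum v) :
    N = 1 ∨ ∃ j, N = k * n ^ j / Nat.gcd r.natAbs (k * n ^ j) := by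
  obtain ⟨hpos, h, hh⟩ := hN
  simp only [commute_coe_pow_iff hv] at hh
  rcases forall_commute_or_exists_iff hn _
    (mul_ne_zero hr (by exact_mod_cast hpos.ne')) ((hh N).2 dvd_rfl) with hall | ⟨j, hj⟩
  · exact Or.inl (Nat.dvd_one.1 ((hh 1).1 (hall _)))
  · refine Or.inr ⟨j, ?_⟩
    simp only [hj, dvd_mul_natCast_iff hr] at hh
    exact Nat.dvd_antisymm ((hh _).1 dvd_rfl) ((hh _).2 dvd_rfl)

/-- The witness is a power, lying in `H`, of a conjugated hill. Hills have depth `i + 1`, hence the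
restriction `1 ≤ j`. -/
theorem mem_commSpectrum (hk : 1 < k) {H : Subgroup (Ext k n)} [H.FiniteIndex] {v : H}
    {g : Ext k n} {r : ℤ} (hr : r ≠ 0) (hv : (v : Ext k n) = g * aPow k n r * g⁻¹) {j : ℕ}
    (hj : 1 ≤ j) : k * n ^ j / Nat.gcd r.natAbs (k * n ^ j) ∈ commSpectrum v := by
  obtain ⟨i, rfl⟩ := Nat.exists_eq_add_of_le' hj
  have hpos : 0 < k * n ^ (i + 1) := Nat.mul_pos (by omega) (pow_pos (NeZero.pos n) _)
  refine ⟨Nat.div_pos (Nat.le_of_dvd hpos (Nat.gcd_dvd_right _ _))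
    (Nat.gcd_pos_of_pos_right _ hpos), ?_⟩
  obtain ⟨M, hM, -, hmem⟩ := Subgroup.exists_pow_mem_of_index_ne_zero
    (Subgroup.FiniteIndex.index_ne_zero (H := H)) (g * syllableProd _ (hill i) * g⁻¹)
  refine ⟨⟨_, hmem⟩, fun m => ?_⟩
  rw [commute_coe_pow_iff hv, ← dvd_mul_natCast_iff hr,
    ← commute_aPow_hill_pow_iff hk i hM (r * m)]
  simp only [conj_pow]
  simp [mul_assoc]

theorem exists_conj_aPow_of_pow_conj {g h : Ext k n} {p q : ℕ} (hpq : p < q)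
    (hconj : h * g ^ p * h⁻¹ = g ^ q) : ∃ x r, g = x * aPow k n r * x⁻¹ := by
  obtain ⟨x, b, hb⟩ := exists_conj_of_of_pow_conj _ hpq hconj
  exact ⟨x, toAdd b, hb⟩

/-- A finite-index subgroup of `BS(k, kn)` contains a power of `a` distorted by conjugation. -/
theorem exists_aPow_mem_and_conj (hk : 1 < k) (hn : 1 < n) (H : Subgroup (Ext k n))
    [H.FiniteIndex] :
    ∃ (v h : H) (r : ℤ) (q : ℕ), r ≠ 0 ∧ (v : Ext k n) = aPow k n r ∧ k < q ∧
      h * v ^ k * h⁻¹ = v ^ q := by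
  have hidx := Subgroup.FiniteIndex.index_ne_zero (H := H)
  obtain ⟨r, hr, -, hrm⟩ := Subgroup.exists_pow_mem_of_index_ne_zero hidx (aPow k n 1)
  obtain ⟨s, hs, -, hsm⟩ := Subgroup.exists_pow_mem_of_index_ne_zero hidx (t : Ext k n)
  -- Conjugation by `t ^ s` raises `a ^ (k * r)` to its `n ^ s`-th power, and `k < k * n ^ s`
  -- because `s > 0`.
  refine ⟨⟨_, hrm⟩, ⟨_, hsm⟩, r, k * n ^ s, by exact_mod_cast hr.ne', ?_, ?_, ?_⟩
  · simp [aPow_pow]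
  · exact lt_mul_of_one_lt_right (by omega) (Nat.one_lt_pow hs.ne' hn)
  · apply Subtype.ext
    have := t_pow_mul_aPow (k := k) (n := n) s r
    simp only [Subgroup.coe_mul, Subgroup.coe_pow, Subgroup.coe_inv, aPow_pow, one_mul]
    rw [mul_comm (r : ℤ), this]
    congr 1
    push_cast
    ring

/-- The relation `h * v ^ k₁ * h⁻¹ = v ^ q` is carried along by `e`, so `e v` is conjugate to a
power of `a`, nontrivial by injectivity. The single set `commSpectrum v` is then computed on both
sides. -/
theorem eq_of_finiteIndex_mulEquiv {k₁ n₁ k₂ n₂ : ℕ} [NeZero n₁] [NeZero n₂]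
    (hk₁ : 1 < k₁) (hn₁ : 1 < n₁) (hk₂ : 1 < k₂) (hn₂ : 1 < n₂)
    (H₁ : Subgroup (Ext k₁ n₁)) (H₂ : Subgroup (Ext k₂ n₂)) [H₁.FiniteIndex] [H₂.FiniteIndex]
    (e : H₁ ≃* H₂) : n₁ = n₂ := by
  obtain ⟨v, h, r, q, hr, hv, hq, hconj⟩ := exists_aPow_mem_and_conj hk₁ hn₁ H₁
  have hv' : (v : Ext k₁ n₁) = 1 * aPow k₁ n₁ r * 1⁻¹ := by simp [hv]
  have hconj' : (e h : Ext k₂ n₂) * (e v : Ext k₂ n₂) ^ k₁ * (e h : Ext k₂ n₂)⁻¹ =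
      (e v : Ext k₂ n₂) ^ q := by
    simpa using congrArg (fun x => (e x : Ext k₂ n₂)) hconj
  obtain ⟨x, r', hx⟩ := exists_conj_aPow_of_pow_conj hq hconj'
  have hr' : r' ≠ 0 := by
    rintro rfl
    have h1 : e v = 1 := Subtype.ext (by simpa using hx)
    have h2 : v = 1 := by simpa using h1
    rw [h2, Subgroup.coe_one, ← aPow_zero] at hv
    exact hr (aPow_injective hv).symm
  refine (eventuallyGeometric_div_gcd (zero_lt_one.trans hk₁) (NeZero.pos _) (Int.natAbs_pos.2 hr)).ratio_eq
    (eventuallyGeometric_div_gcd (zero_lt_one.trans hk₂) (NeZero.pos _) (Int.natAbs_pos.2 hr'))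
    hn₁ hn₂ (S := commSpectrum v) (fun j hj => mem_commSpectrum hk₁ hr hv' hj)
    (fun j hj => ?_) (fun N hN => eq_one_or_exists_of_mem_commSpectrum hn₁ hr hv' hN)
    (fun N hN => ?_)
  · rw [← commSpectrum_map e]
    exact mem_commSpectrum hk₂ hr' hx hj
  · rw [← commSpectrum_map e] at hN
    exact eq_one_or_exists_of_mem_commSpectrum hn₂ hr' hx hN

/-! ### Identification of the presented group with the HNN extension -/

variable (k n)

/-- The comparison map from the presented group to the HNN extension. -/
noncomputable def toExt : BS k (k * n) →* Ext k n :=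
  PresentedGroup.toGroup (f := ![aPow k n 1, t]) (by
    rintro _ rfl
    have := t_mul_aPow (k := k) (n := n) 1
    have hz : ∀ N : ℤ, aPow k n 1 ^ N = aPow k n N := fun N => by
      rw [aPow, aPow, ← map_zpow, ← ofAdd_zsmul]; simp
    simp only [mul_one] at this
    simp only [BSRelator, map_mul, map_inv, map_zpow, FreeGroup.lift_apply_of, Matrix.cons_val_zero,
      Matrix.cons_val_one, hz]
    rw [this, mul_inv_cancel_right, mul_inv_cancel])

/-- The comparison map from the HNN extension to the presented group. -/
noncomputable def ofExt : Ext k n →* BS k (k * n) :=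
  HNNExtension.lift (zpowersHom _ (PresentedGroup.of 0)) (PresentedGroup.of 1) (by
    rintro ⟨x, hx⟩
    obtain ⟨z, rfl⟩ := ofAdd.surjective x
    obtain ⟨q, rfl⟩ := ofAdd_mem_lowerSubgroup.1 hx
    have hφ : (scaleEquiv k n ⟨_, hx⟩ : Multiplicative ℤ) = ofAdd (k * n * q : ℤ) := by
      change (ofAdd (k * q : ℤ)) ^ n = _
      rw [← ofAdd_nsmul]; congr 1; simp; ring
    have hrel : (PresentedGroup.of 1 * PresentedGroup.of 0 ^ (k : ℤ) * (PresentedGroup.of 1)⁻¹ :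
        BS k (k * n)) = PresentedGroup.of 0 ^ (k * n : ℤ) :=
      mul_inv_eq_one.1 (PresentedGroup.one_of_mem (rels := {BSRelator k (k * n)}) rfl)
    rw [hφ, zpowersHom_apply, zpowersHom_apply, toAdd_ofAdd, toAdd_ofAdd, zpow_mul, zpow_mul,
      ← hrel, conj_zpow, inv_mul_cancel_right])

/-- The Baumslag--Solitar group `BS(k, kn)` is an HNN extension of the infinite cyclic group. -/
noncomputable def equivExt : BS k (k * n) ≃* Ext k n :=
  (toExt k n).toMulEquiv (ofExt k n)
    (PresentedGroup.ext fun x => by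
      fin_cases x
      · simp [toExt, ofExt, aPow]
      · simp [toExt, ofExt])
    (HNNExtension.hom_ext (MonoidHom.ext_mint (by simp [toExt, ofExt, aPow]))
      (by simp [toExt, ofExt]))

end BaumslagSolitar

theorem mainTheorem6 (k₁ n₁ k₂ n₂ : ℤ) (hk₁ : 1 < k₁) (hn₁ : 1 < n₁) (hk₂ : 1 < k₂) (hn₂ : 1 < n₂)
    (hcomm : AbstractlyCommensurable (BS k₁ (k₁ * n₁)) (BS k₂ (k₂ * n₂))) :
    n₁ = n₂ := by
  lift k₁ to ℕ using by omega
  lift n₁ to ℕ using by omega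
  lift k₂ to ℕ using by omega
  lift n₂ to ℕ using by omega
  norm_cast at hk₁ hn₁ hk₂ hn₂
  have : NeZero n₁ := ⟨by omega⟩
  have : NeZero n₂ := ⟨by omega⟩
  obtain ⟨G, H, hG, hH, ⟨e⟩⟩ := hcomm
  let e₁ := BaumslagSolitar.equivExt k₁ n₁
  let e₂ := BaumslagSolitar.equivExt k₂ n₂
  have : (G.map (e₁ : BS k₁ (k₁ * n₁) →* BaumslagSolitar.Ext k₁ n₁)).FiniteIndex :=
    ⟨by rw [Subgroup.index_map_equiv]; exact hG.index_ne_zero⟩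
  have : (H.map (e₂ : BS k₂ (k₂ * n₂) →* BaumslagSolitar.Ext k₂ n₂)).FiniteIndex :=
    ⟨by rw [Subgroup.index_map_equiv]; exact hH.index_ne_zero⟩
  rw [Nat.cast_inj]
  exact BaumslagSolitar.eq_of_finiteIndex_mulEquiv hk₁ hn₁ hk₂ hn₂ _ _
    (((e₁.subgroupMap G).symm.trans e).trans (e₂.subgroupMap H))
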